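/- A stochastic graph $G=(U,V,U\times V)$ consists of finite sets $U$ (offline vertices) and $V$, edge probabilities $p_{u,v}\in[0,1]$, arbitrary real edge weights $w_{u,v}$ and patience values $\ell_v\in\{0,1,2,\dots\}$. Each edge $(u,v)$ is independently active with probability $p_{u,v}$, and its state is revealed only when it is probed. A committal probing algorithm probes edges one after another, adaptively and possibly using randomness, probing at most $\ell_v$ edges at each $v\in V$; whenever a probed edge $(u,v)$ is active and $u$ and $v$ are both unmatched, $(u,v)$ must be added to the current matching. Let $\mathrm{OPT}(G)$ be the supremum, over all such algorithms, of the expected weight of the final matching. A known i.i.d. input $(G,\mathbf r,n)$ consists of a stochastic (type) graph $G$, an integer $n\ge 1$ and real arrival rates $r_v>0$ ($v\in V$) with $\sum_{v\in V} r_v=n$. Arrivals $v_1,\dots,v_n\in V$ are drawn independently with $\mathbb P[v_t=v]=r_v/n$. The instantiated graph $\hat G$ has offline vertices $U$ and online vertices $1,\dots,n$, where vertex $t$ has the edge probabilities, edge weights and patience of the type node $v_t$ and its own independent edge states. The committal benchmark is $\mathrm{OPT}(G,\mathbf r,n)=\mathbb E[\mathrm{OPT}(\hat G)]$. Let $U^{(\le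 k)}$ be the set of nonempty tuples of distinct elements of $U$ of length at most $k$. For $\mathbf u=(u_1,\dots,u_k)$ let $g_v^i(\mathbf u)=p_{u_i,v}\prod_{j<i}(1-p_{u_j,v})$. Consider the linear program (LP-new-iid) in the variables $y_v(\mathbf u)$, $v\in V$, $\mathbf u\in U^{(\le \ell_v)}$: $$\text{maximize}\quad \sum_{v\in V}\sum_{\mathbf u\in U^{(\le \ell_v)}}\Big(\sum_{i=1}^{|\mathbf u|}w_{u_i,v}\,g_v^i(\mathbf u)\Big)y_v(\mathbf u)$$ subject to $$\sum_{v\in V}\ \sum_{\mathbf u\in U^{(\le \ell_v)}}\ \sum_{i:\,u_i=u} g_v^i(\mathbf u)\,y_v(\mathbf u)\le 1\ \ (u\in U),\qquad \sum_{\mathbf u\in U^{(\le \ell_v)}}y_v(\mathbf u)\le r_v\ \ (v\in V),\qquad y_v(\mathbf u)\ge 0 .$$ Given an optimal solution $y$ of this program, Algorithm "Known I.I.D." starts with the empty matching $\mathcal M$ and, for $t=1,\dots,n$, runs VertexProbe for the arriving vertex with the values $y_{v}(\mathbf u)/r_{v}$, where $v=v_t$: independently of everything else it draws $\mathbf u\in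 U^{(\le \ell_v)}$ with probability $y_v(\mathbf u)/r_v$, and passes with the remaining probability. If a tuple was drawn, it probes the edges from vertex $t$ to the entries of $\mathbf u$ in order until the first active edge is found. If an active edge is found and its offline endpoint is currently unmatched in $\mathcal M$, this edge is added to $\mathcal M$. **Theorem.** For every known i.i.d. input $(G,\mathbf r,n)$, the program (LP-new-iid) has an optimal solution, and for every optimal solution $y$ the matching $\mathcal M$ returned by Algorithm "Known I.I.D." run with $y$ satisfies $$\mathbb E[\mathrm{weight}(\mathcal M)]\ \ge\ \Big(1-\frac1e\Big)\,\mathrm{OPT}(G,\mathbf r,n),$$ where the expectation is over the arrivals, the edge states and the random choices of the algorithm. That is, the algorithm is $(1-1/e)$-competitive against the committal benchmark. -/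

import Mathlib

/-- A bipartite stochastic graph with offline vertices `U`, online vertices `V` and edge set
`U × V`: edge probabilities, edge weights, and a patience for every online vertex.
(A pair is excluded from being an edge by giving it probability `0`.) -/
structure StochasticGraph (U V : Type*) where
  prob : U → V → ℝ
  weight : U → V → ℝ
  patience : V → ℕ
  prob_nonneg : ∀ u v, 0 ≤ prob u v
  prob_le_one : ∀ u v, prob u v ≤ 1

/-- A (partial) assignment of offline vertices to online vertices: `M v = some u` means that
`v` is matched to `u`, and `M v = none` that `v` is unmatched. -/
abbrev Assignment (U V : Type*) := V → Option U

namespace Assignment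

variable {U V : Type*} [DecidableEq U] [Fintype V] [DecidableEq V]

/-- Add the edge `(u, v)` to the current matching if both `u` and `v` are unmatched. -/
def add (M : Assignment U V) (u : U) (v : V) : Assignment U V :=
  if M v = none ∧ ∀ v', M v' ≠ some u then Function.update M v (some u) else M

end Assignment

/-- An adaptive (offline) probing algorithm, as a decision tree: it halts, or it probes the edge
`(u, v)` and continues according to whether this edge is active or inactive, or it flips a coin
(independent of everything else) of bias `q`. -/
inductive ProbingAlgorithm (U V : Type*) where
  | halt : ProbingAlgorithm U V
  | probe (u : U) (v : V) (ifActive ifInactive : ProbingAlgorithm U V) : ProbingAlgorithm U V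
  | flip (q : unitInterval) (ifHeads ifTails : ProbingAlgorithm U V) : ProbingAlgorithm U V

namespace ProbingAlgorithm

variable {U V : Type*} [DecidableEq V]

/-- On every branch, each online vertex `v` takes part in at most `b v` probes. -/
def RespectsPatience : ProbingAlgorithm U V → (V → ℕ) → Prop
  | halt, _ => True
  | probe _ v A B, b =>
      0 < b v ∧ A.RespectsPatience (Function.update b v (b v - 1)) ∧
        B.RespectsPatience (Function.update b v (b v - 1))
  | flip _ A B, b => A.RespectsPatience b ∧ B.RespectsPatience b

end ProbingAlgorithm

namespace StochasticGraph

section Benchmark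

variable {U V : Type*} [Fintype U] [DecidableEq U] [Fintype V] [DecidableEq V]

/-- The probability of the joint edge states `st` (`st u v = true` iff `(u, v)` is active):
the states of the edges are independent Bernoulli variables. -/
def stateProb (G : StochasticGraph U V) (st : U → V → Bool) : ℝ :=
  ∏ u, ∏ v, if st u v then G.prob u v else 1 - G.prob u v

/-- The weight of a matching. -/
def val (G : StochasticGraph U V) (M : Assignment U V) : ℝ :=
  ∑ v, (M v).elim 0 (fun u => G.weight u v)

/-- Expected weight (over the coin flips) of the final matching, when a probing algorithm is run
on the edge states `st` from the current matching `M`. Commitment is respected: an edge that is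
probed and found active is added to the current matching if possible. -/
noncomputable def valueOn (G : StochasticGraph U V) (st : U → V → Bool) :
    ProbingAlgorithm U V → Assignment U V → ℝ
  | .halt, M => G.val M
  | .probe u v A B, M =>
      if st u v then G.valueOn st A (M.add u v) else G.valueOn st B M
  | .flip q A B, M => (q : ℝ) * G.valueOn st A M + (1 - (q : ℝ)) * G.valueOn st B M

/-- The expected weight of the matching that the probing algorithm `A` builds on `G`. -/
noncomputable def expectedValue (G : StochasticGraph U V) (A : ProbingAlgorithm U V) : ℝ :=
  ∑ st : U → V → Bool, G.stateProb st * G.valueOn st A (fun _ => none)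

/-- The expected values attained on `G` by the committal probing algorithms that respect the
patience constraints. -/
def committalValues (G : StochasticGraph U V) : Set ℝ :=
  {x | ∃ A : ProbingAlgorithm U V, A.RespectsPatience G.patience ∧ x = G.expectedValue A}

/-- `OPT(G)`, the value of the committal benchmark. (The set is nonempty and bounded above, by
the two lemmas that follow.) -/
noncomputable def OPT (G : StochasticGraph U V) : ℝ := sSup G.committalValues

theorem committalValues_nonempty (G : StochasticGraph U V) : G.committalValues.Nonempty :=
  ⟨_, .halt, trivial, rfl⟩

theorem committalValues_bddAbove (G : StochasticGraph U V) : BddAbove G.committalValues := by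
  have hval : ∀ M, G.val M ≤ ∑ v, ∑ u, |G.weight u v| := by
    intro M
    refine Finset.sum_le_sum fun v _ => ?_
    cases M v with
    | none => exact Finset.sum_nonneg fun u _ => abs_nonneg (G.weight u v)
    | some u =>
      exact (le_abs_self (G.weight u v)).trans (Finset.single_le_sum
        (f := fun u => |G.weight u v|) (fun u _ => abs_nonneg (G.weight u v)) (Finset.mem_univ u))
  have hrun : ∀ st A M, G.valueOn st A M ≤ ∑ v, ∑ u, |G.weight u v| := by
    intro st A
    induction A with
    | halt => exact fun M => hval M
    | probe u v A B hA hB =>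
      intro M
      simp only [valueOn]
      split_ifs
      · exact hA _
      · exact hB _
    | flip q A B hA hB =>
      intro M
      simp only [valueOn]
      have h0 := q.2.1
      have h1 := q.2.2
      nlinarith [hA M, hB M]
  refine ⟨∑ st, G.stateProb st * ∑ v, ∑ u, |G.weight u v|, ?_⟩
  rintro x ⟨A, -, rfl⟩
  refine Finset.sum_le_sum fun st _ => mul_le_mul_of_nonneg_left (hrun st A _) ?_
  refine Finset.prod_nonneg fun u _ => Finset.prod_nonneg fun v _ => ?_
  have h0 := G.prob_nonneg u v
  have h1 := G.prob_le_one u v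
  split_ifs <;> linarith

end Benchmark

end StochasticGraph

/-- `U^(≤ k)`: the nonempty tuples of distinct elements of `U`, of length at most `k`. -/
abbrev DistinctTuple (U : Type*) (k : ℕ) := {l : List U // l.Nodup ∧ l ≠ [] ∧ l.length ≤ k}

noncomputable instance DistinctTuple.instFintype (U : Type*) [Fintype U] [DecidableEq U] (k : ℕ) :
    Fintype (DistinctTuple U k) :=
  Fintype.ofInjective (fun l => (⟨l.1, l.2.1⟩ : {l : List U // l.Nodup}))
    (fun _ _ h => Subtype.ext (congrArg (fun x : {l : List U // l.Nodup} => x.1) h))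

namespace StochasticGraph

section KnownIID

variable {U V : Type*} [Fintype U] [DecidableEq U] [Fintype V]

/-- `g_v^i(l)`: the probability that `(l_i, v)` is the first active edge when the edges from `v`
to the entries of the tuple `l` are revealed in order. -/
noncomputable def firstActiveProb (G : StochasticGraph U V) (v : V) (l : List U)
    (i : Fin l.length) : ℝ :=
  G.prob (l.get i) v * ∏ j : Fin l.length with j < i, (1 - G.prob (l.get j) v)

/-- Variables `y_v(l)` of the linear program, for `v ∈ V` and `l ∈ U^(≤ ℓ_v)`. -/
abbrev LPVar (G : StochasticGraph U V) := (v : V) → DistinctTuple U (G.patience v) → ℝ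

/-- The objective of the linear program. -/
noncomputable def lpObjective (G : StochasticGraph U V) (y : G.LPVar) : ℝ :=
  ∑ v, ∑ l : DistinctTuple U (G.patience v),
    (∑ i : Fin l.1.length, G.weight (l.1.get i) v * G.firstActiveProb v l.1 i) * y v l

/-- The constraints of the linear program for the arrival rates `r`. -/
structure LPFeasible (G : StochasticGraph U V) (r : V → ℝ) (y : G.LPVar) : Prop where
  matching : ∀ u : U, ∑ v, ∑ l : DistinctTuple U (G.patience v),
    ∑ i : Fin l.1.length with l.1.get i = u, G.firstActiveProb v l.1 i * y v l ≤ 1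
  rate : ∀ v, ∑ l : DistinctTuple U (G.patience v), y v l ≤ r v
  nonneg : ∀ v l, 0 ≤ y v l

/-- `y` is an optimal solution of the linear program for the arrival rates `r`. -/
structure LPOptimal (G : StochasticGraph U V) (r : V → ℝ) (y : G.LPVar) : Prop where
  feasible : G.LPFeasible r y
  optimal : ∀ y' : G.LPVar, G.LPFeasible r y' → G.lpObjective y' ≤ G.lpObjective y

/-- The instantiated graph: its online vertices are the `n` rounds, and the vertex of round `t`
is a fresh copy of the type node `σ t`. -/
def instantiate (G : StochasticGraph U V) {n : ℕ} (σ : Fin n → V) : StochasticGraph U (Fin n) where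
  prob u t := G.prob u (σ t)
  weight u t := G.weight u (σ t)
  patience t := G.patience (σ t)
  prob_nonneg u t := G.prob_nonneg u (σ t)
  prob_le_one u t := G.prob_le_one u (σ t)

/-- The probability that the sequence of arrivals is `σ`: the `n` arrivals are drawn independently
from the distribution `r / n`. -/
noncomputable def arrivalProb (r : V → ℝ) {n : ℕ} (σ : Fin n → V) : ℝ := ∏ t, r (σ t) / n

/-- `OPT(G, r, n)`: the expected value of the committal benchmark on the instantiated graph. -/
noncomputable def OPTiid (G : StochasticGraph U V) (r : V → ℝ) (n : ℕ) : ℝ :=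
  ∑ σ : Fin n → V, arrivalProb r σ * (G.instantiate σ).OPT

/-- The random choice made by `VertexProbe` from the values `x`: pass (`none`) with probability
`1 - ∑ l, x l`, and draw the tuple `l` with probability `x l`. -/
noncomputable def drawProb {k : ℕ} (x : DistinctTuple U k → ℝ) :
    Option (DistinctTuple U k) → ℝ
  | none => 1 - ∑ l, x l
  | some l => x l

/-- The rest of `VertexProbe`: probe the entries of the drawn tuple in order until the first
active edge is found, and return its offline endpoint, if there is one. -/
def vertexProbe {k : ℕ} (st : U → Bool) (d : Option (DistinctTuple U k)) : Option U :=
  d.bind (fun l => l.1.find? st)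

/-- The matching built by the algorithm on the arrivals `σ`, with the tuples `d` drawn in the calls
of `VertexProbe` and the edge states `st`. In the rounds `t = 0, …, n - 1`, in this order, if
`VertexProbe` returns `u` and `u` is unmatched, then the vertex of round `t` is matched to `u`. -/
def iidMatching (G : StochasticGraph U V) {n : ℕ} (σ : Fin n → V)
    (d : (t : Fin n) → Option (DistinctTuple U (G.patience (σ t)))) (st : U → Fin n → Bool) :
    Assignment U (Fin n) :=
  (List.finRange n).foldl
    (fun M t => (vertexProbe (fun u => st u t) (d t)).elim M (fun u => M.add u t))
    (fun _ => none)

/-- The expected weight of the matching built by the algorithm that uses the LP solution `y`, over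
the arrivals, the independent draws of `VertexProbe` (in round `t`, with the values
`y_v(l) / r_v`, where `v` is the type of the arriving vertex), and the independent edge states of
the instantiated graph. -/
noncomputable def iidAlgValue (G : StochasticGraph U V) (r : V → ℝ) (n : ℕ) (y : G.LPVar) : ℝ :=
  ∑ σ : Fin n → V, arrivalProb r σ *
    ∑ d : (t : Fin n) → Option (DistinctTuple U (G.patience (σ t))),
      (∏ t, drawProb (fun l => y (σ t) l / r (σ t)) (d t)) *
        ∑ st : U → Fin n → Bool,
          (G.instantiate σ).stateProb st * (G.instantiate σ).val (G.iidMatching σ d st)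

end KnownIID

end StochasticGraph

/-! Two facts carry the theorem: the linear program is a relaxation of the benchmark
(`OPTiid_le_lpObjective`), and the algorithm keeps a fraction `1 - 1/e` of what each offline vertex
contributes to the objective.

For the relaxation, fix the arrivals and a committal algorithm. Seen from one online vertex `t`, the
rest of the run is only a source of randomness, and an active probe of a free offline vertex settles
the fate of `t`. Hence the vector of probabilities that `t` is matched to each `u` is a convex
combination of the first-active vectors of tuples (`matchProb_mem_probeHull`, by induction on the
decision tree). Summing over rounds and averaging over arrivals gives a feasible point with the same
expected weight.

For the algorithm, the rounds are independent and identically distributed. Each proposes to `u` with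
probability `a ≤ 1/n`, and `u` is still free in round `t` with probability `(1 - a) ^ t`. So `u`
earns its share of the objective times the average of these powers (`iidAlgValue_eq`), which is at
least `1 - 1/e` (`sum_range_pow_div_ge`).

Weights may be negative, so the comparison for each `u` also needs its share to be nonnegative. This
follows from optimality: `u` can be removed from a solution without changing the marginals of the
other offline vertices (`sum_weight_mul_lpMarginal_nonneg`). -/

open Finset

/-! ### The first active entry of a tuple. -/

section FirstActive

variable {U : Type*} [DecidableEq U]

/-- The probability that `u` is the first active entry of a tuple, when the entries are active
independently with probabilities `p`. -/
def firstActive (p : U → ℝ) : List U → U → ℝ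
  | [], _ => 0
  | a :: l, u => (if a = u then p a else 0) + (1 - p a) * firstActive p l u

theorem firstActive_nonneg {p : U → ℝ} (h0 : ∀ u, 0 ≤ p u) (h1 : ∀ u, p u ≤ 1) (l : List U)
    (u : U) : 0 ≤ firstActive p l u := by
  induction l with
  | nil => exact le_rfl
  | cons a l ih =>
    simp only [firstActive]
    have := mul_nonneg (sub_nonneg.2 (h1 a)) ih
    have := h0 a
    split_ifs <;> linarith

theorem firstActive_update_of_notMem (p : U → ℝ) (a : U) (x : ℝ) {l : List U} (ha : a ∉ l)
    (u : U) : firstActive (Function.update p a x) l u = firstActive p l u := by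
  induction l with
  | nil => rfl
  | cons b l ih =>
    simp only [List.mem_cons, not_or] at ha
    simp [firstActive, ih ha.2, Function.update_of_ne (Ne.symm ha.1)]

/-- The tuple-wise form of the matching constraint of the linear program. -/
theorem StochasticGraph.sum_firstActiveProb_eq {V : Type*} (G : StochasticGraph U V) (v : V)
    (l : List U) (u : U) :
    ∑ i : Fin l.length with l.get i = u, G.firstActiveProb v l i =
      firstActive (fun u => G.prob u v) l u := by
  induction l with
  | nil => simp [firstActive]
  | cons a l ih =>
    have hg : ∀ i : Fin l.length, G.firstActiveProb v (a :: l) i.succ =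
        (1 - G.prob a v) * G.firstActiveProb v l i := by
      intro i
      simp only [StochasticGraph.firstActiveProb, prod_filter, List.length_cons]
      rw [Fin.prod_univ_succ]
      simp
      ring
    have h0 : G.firstActiveProb v (a :: l) (0 : Fin (l.length + 1)) = G.prob a v := by
      simp [StochasticGraph.firstActiveProb]
    rw [sum_filter] at ih ⊢
    simp only [List.length_cons]
    rw [Fin.sum_univ_succ, h0, firstActive, ← ih, mul_sum]
    congr 1
    refine sum_congr rfl fun i _ => ?_
    simp only [List.get_cons_succ', hg, mul_ite, mul_zero]

/-- The tuple-wise form of the objective of the linear program. -/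
theorem StochasticGraph.sum_mul_firstActiveProb_eq [Fintype U] {V : Type*}
    (G : StochasticGraph U V) (v : V) (l : List U) (f : U → ℝ) :
    ∑ i : Fin l.length, f (l.get i) * G.firstActiveProb v l i =
      ∑ u, f u * firstActive (fun u => G.prob u v) l u := by
  rw [← sum_fiberwise_of_maps_to (s := univ) (t := univ) (g := l.get) (by simp)]
  refine sum_congr rfl fun u _ => ?_
  rw [← G.sum_firstActiveProb_eq, mul_sum]
  refine sum_congr rfl fun i hi => ?_
  rw [(mem_filter.1 hi).2]

end FirstActive

/-! ### Independent edge states. -/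

section Bernoulli

variable {U : Type*} [Fintype U]

/-- The probability of `c` when its entries are independent Bernoulli variables with means `q`. -/
def bernoulliProb (q : U → ℝ) (c : U → Bool) : ℝ := ∏ u, if c u then q u else 1 - q u

theorem bernoulliProb_nonneg {q : U → ℝ} (h0 : ∀ u, 0 ≤ q u) (h1 : ∀ u, q u ≤ 1)
    (c : U → Bool) : 0 ≤ bernoulliProb q c := by
  refine prod_nonneg fun u _ => ?_
  have := h0 u
  have := h1 u
  split_ifs <;> linarith

variable [DecidableEq U]

theorem sum_bernoulliProb (q : U → ℝ) : ∑ c, bernoulliProb q c = 1 := by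
  have h := Fintype.prod_sum (fun (u : U) (b : Bool) => if b then q u else 1 - q u)
  simp only [bernoulliProb]
  rw [← h]
  simp

theorem bernoulliProb_update (q : U → ℝ) (a : U) (x : ℝ) (c : U → Bool) :
    bernoulliProb (Function.update q a x) c =
      (if c a then x else 1 - x) * ∏ u ∈ univ.erase a, if c u then q u else 1 - q u := by
  rw [bernoulliProb, ← mul_prod_erase univ _ (mem_univ a)]
  congr 1
  · simp
  · refine prod_congr rfl fun u hu => ?_
    rw [Function.update_of_ne (ne_of_mem_erase hu)]

/-- Revealing the entry `a` first. -/
theorem sum_bernoulliProb_mul_ite (q : U → ℝ) (a : U) (f g : (U → Bool) → ℝ) :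
    ∑ c, bernoulliProb q c * (if c a then f c else g c) =
      q a * ∑ c, bernoulliProb (Function.update q a 1) c * f c +
        (1 - q a) * ∑ c, bernoulliProb (Function.update q a 0) c * g c := by
  rw [mul_sum, mul_sum, ← sum_add_distrib]
  refine sum_congr rfl fun c _ => ?_
  -- Written as its own update at `a`, `q` shares the factor over the other entries with both
  -- conditioned laws.
  rw [← Function.update_eq_self a q, Function.update_idem, Function.update_idem]
  simp only [bernoulliProb_update, Function.update_self]
  split_ifs <;> ring

/-- The distribution of the first active entry of a tuple of distinct entries. -/
theorem sum_bernoulliProb_find (q : U → ℝ) {l : List U} (hl : l.Nodup) (u : U) :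
    ∑ c, bernoulliProb q c * (if l.find? c = some u then 1 else 0) = firstActive q l u := by
  induction l generalizing q with
  | nil => simp [firstActive]
  | cons a l ih =>
    rw [List.nodup_cons] at hl
    have h : ∀ c : U → Bool, (if (a :: l).find? c = some u then (1 : ℝ) else 0) =
        if c a then (if a = u then 1 else 0) else (if l.find? c = some u then 1 else 0) := by
      intro c
      cases hc : c a <;> simp [hc]
    simp only [h]
    -- As `a ∉ l`, conditioning on the state of `a` does not affect the tail.
    rw [sum_bernoulliProb_mul_ite, ih _ hl.2, ← sum_mul, sum_bernoulliProb,
      firstActive_update_of_notMem _ _ _ hl.1, firstActive]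
    split_ifs <;> ring

end Bernoulli

/-! ### Convex combinations of tuples. -/

section ProbeHull

variable {U : Type*} [DecidableEq U]

/-- The vectors of matching probabilities of one online vertex that are attained by randomizing
over the tuples of at most `b` distinct elements of `S`. -/
def probeHull (p : U → ℝ) (b : ℕ) (S : Finset U) : Set (U → ℝ) :=
  convexHull ℝ {z | ∃ l : List U, l.Nodup ∧ l.length ≤ b ∧ (∀ a ∈ l, a ∈ S) ∧ z = firstActive p l}

theorem probeHull_mono (p : U → ℝ) {b b' : ℕ} {S S' : Finset U} (hb : b ≤ b') (hS : S ⊆ S') :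
    probeHull p b S ⊆ probeHull p b' S' := by
  refine convexHull_mono ?_
  rintro z ⟨l, h1, h2, h3, rfl⟩
  exact ⟨l, h1, h2.trans hb, fun a ha => hS (h3 a ha), rfl⟩

theorem convex_probeHull (p : U → ℝ) (b : ℕ) (S : Finset U) : Convex ℝ (probeHull p b S) :=
  convex_convexHull _ _

theorem zero_mem_probeHull (p : U → ℝ) (b : ℕ) (S : Finset U) : 0 ∈ probeHull p b S :=
  subset_convexHull _ _ ⟨[], by simp, by simp, by simp, rfl⟩

/-- Prepending `a` acts on vectors by an affine map, so it is enough to check it on the generators.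
-/
theorem probeHull_cons (p : U → ℝ) {b : ℕ} {S : Finset U} {a : U} (ha : a ∈ S) {z : U → ℝ}
    (hz : z ∈ probeHull p b (S.erase a)) :
    (fun u => (if a = u then p a else 0) + (1 - p a) * z u) ∈ probeHull p (b + 1) S := by
  suffices h : probeHull p b (S.erase a) ⊆
      {z | (fun u => (if a = u then p a else 0) + (1 - p a) * z u) ∈ probeHull p (b + 1) S} from
    h hz
  refine convexHull_min ?_ ?_
  · rintro z ⟨l, h1, h2, h3, rfl⟩
    refine subset_convexHull _ _ ⟨a :: l, ?_, ?_, ?_, ?_⟩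
    · exact List.nodup_cons.2 ⟨fun h => by simpa using h3 a h, h1⟩
    · simpa using h2
    · intro c hc
      rcases List.mem_cons.1 hc with rfl | hc
      · exact ha
      · exact mem_of_mem_erase (h3 c hc)
    · rfl
  · intro x hx y hy s t hs ht hst
    have := convex_probeHull p (b + 1) S hx hy hs ht hst
    refine (congrArg (· ∈ probeHull p (b + 1) S) ?_).mp this
    funext u
    simp only [Pi.add_apply, Pi.smul_apply, smul_eq_mul]
    rw [show t = 1 - s by linarith]
    ring

/-- Some randomization over tuples is never matched to `u`, and is matched to the other offline
vertices with the same probabilities as the tuple `l`. -/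
theorem update_firstActive_mem_probeHull {p : U → ℝ} (h0 : ∀ u, 0 ≤ p u) (h1 : ∀ u, p u ≤ 1)
    (u : U) {l : List U} (hl : l.Nodup) {S : Finset U} (hS : ∀ a ∈ l, a ∈ S) :
    Function.update (firstActive p l) u 0 ∈ probeHull p l.length S := by
  induction l generalizing S with
  | nil =>
    refine (congrArg (· ∈ probeHull p 0 S) ?_).mp (zero_mem_probeHull p 0 S)
    funext x
    by_cases hx : x = u
    · subst hx; simp
    · simp [hx, firstActive]
  | cons a l ih =>
    rw [List.nodup_cons] at hl
    have ih' := ih hl.2 (S := S.erase a) fun c hc =>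
      mem_erase.2 ⟨fun h => hl.1 (h ▸ hc), hS c (List.mem_cons_of_mem _ hc)⟩
    by_cases hau : a = u
    · subst hau
      -- The probe of `a` is simulated by a coin: pass with probability `p a`, otherwise continue
      -- with the substitute for the tail.
      have := convex_probeHull p (l.length + 1) S (zero_mem_probeHull p _ S)
        (probeHull_mono p (Nat.le_succ _) (erase_subset a S) ih') (h0 a)
        (sub_nonneg.2 (h1 a)) (by ring)
      refine (congrArg (· ∈ probeHull p (l.length + 1) S) ?_).mp this
      funext x
      by_cases hx : x = a
      · subst hx; simp
      · simp [hx, firstActive, Ne.symm hx]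
    · have := probeHull_cons p (hS a List.mem_cons_self) ih'
      refine (congrArg (· ∈ probeHull p (l.length + 1) S) ?_).mp this
      funext x
      by_cases hx : x = u
      · subst hx; simp [hau]
      · simp [hx, firstActive]

/-- The vectors in `probeHull` are the combinations of tuples that the linear program allows. -/
theorem exists_coeff_of_mem_probeHull [Fintype U] {p : U → ℝ} {b : ℕ} {S : Finset U} {z : U → ℝ}
    (hz : z ∈ probeHull p b S) :
    ∃ q : DistinctTuple U b → ℝ, (∀ l, 0 ≤ q l) ∧ ∑ l, q l ≤ 1 ∧
      ∀ u, z u = ∑ l, q l * firstActive p l.1 u := by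
  suffices h : probeHull p b S ⊆ {z | ∃ q : DistinctTuple U b → ℝ, (∀ l, 0 ≤ q l) ∧
      ∑ l, q l ≤ 1 ∧ ∀ u, z u = ∑ l, q l * firstActive p l.1 u} from h hz
  refine convexHull_min ?_ ?_
  · rintro z ⟨l, h1, h2, -, rfl⟩
    -- The empty tuple is not a variable of the program; it corresponds to passing, hence total mass
    -- at most one.
    by_cases hl : l = []
    · subst hl
      exact ⟨0, by simp, by simp, by simp [firstActive]⟩
    · refine ⟨Pi.single ⟨l, h1, hl, h2⟩ 1, ?_, ?_, ?_⟩
      · intro l'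
        rw [Pi.single_apply]
        split_ifs <;> norm_num
      · simp
      · intro u
        simp [Pi.single_apply]
  · rintro x ⟨q, hq0, hq1, hq⟩ y ⟨q', hq0', hq1', hq'⟩ s t hs ht hst
    refine ⟨fun l => s * q l + t * q' l, fun l => ?_, ?_, fun u => ?_⟩
    · exact add_nonneg (mul_nonneg hs (hq0 l)) (mul_nonneg ht (hq0' l))
    · rw [sum_add_distrib, ← mul_sum, ← mul_sum]
      nlinarith
    · simp only [Pi.add_apply, Pi.smul_apply, smul_eq_mul, hq, hq', mul_sum, ← sum_add_distrib]
      exact sum_congr rfl fun l _ => by ring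

end ProbeHull

/-! ### Matching probabilities of adaptive algorithms. -/

namespace ProbingAlgorithm

variable {U V : Type*} [DecidableEq U] [Fintype V] [DecidableEq V]

/-- The probability (over the coin flips) that `u` and `t` are matched to each other in the end,
when a probing algorithm is run on the edge states `st` from the matching `M`. -/
noncomputable def matchProb (st : U → V → Bool) (t : V) (u : U) :
    ProbingAlgorithm U V → Assignment U V → ℝ
  | .halt, M => if M t = some u then 1 else 0
  | .probe a v A B, M =>
      if st a v then A.matchProb st t u (M.add a v) else B.matchProb st t u M
  | .flip q A B, M => (q : ℝ) * A.matchProb st t u M + (1 - (q : ℝ)) * B.matchProb st t u M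

/-- Commitment: `add` never alters a vertex that is already matched. -/
theorem matchProb_of_eq_some (st : U → V → Bool) (t : V) (u : U) (A : ProbingAlgorithm U V)
    {M : Assignment U V} {a : U} (h : M t = some a) :
    A.matchProb st t u M = if a = u then 1 else 0 := by
  induction A generalizing M with
  | halt => simp [matchProb, h]
  | probe c v A B hA hB =>
    simp only [matchProb]
    rw [hB h, hA, ite_self]
    unfold Assignment.add
    split_ifs with hc
    · have hvt : t ≠ v := by
        rintro rfl
        simp [h] at hc
      rw [Function.update_of_ne hvt, h]
    · exact h
  | flip q A B hA hB =>
    simp only [matchProb, hA h, hB h]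
    ring

theorem valueOn_eq_sum_matchProb [Fintype U] (G : StochasticGraph U V) (st : U → V → Bool)
    (A : ProbingAlgorithm U V) (M : Assignment U V) :
    G.valueOn st A M = ∑ t, ∑ u, G.weight u t * A.matchProb st t u M := by
  induction A generalizing M with
  | halt =>
    refine sum_congr rfl fun t _ => ?_
    simp only [matchProb]
    cases M t <;> simp
  | probe c v A B hA hB =>
    simp only [matchProb, StochasticGraph.valueOn]
    split_ifs
    · exact hA _
    · exact hB _
  | flip q A B hA hB =>
    simp only [matchProb, StochasticGraph.valueOn, hA, hB, mul_sum, ← sum_add_distrib]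
    exact sum_congr rfl fun t _ => sum_congr rfl fun u _ => by ring

theorem sum_matchProb_le_one (st : U → V → Bool) (u : U)
    (A : ProbingAlgorithm U V) (M : Assignment U V)
    (hM : ∀ s t, M s = some u → M t = some u → s = t) :
    ∑ t, A.matchProb st t u M ≤ 1 := by
  induction A generalizing M with
  | halt =>
    simp only [matchProb]
    rw [sum_boole]
    exact_mod_cast card_le_one.2 fun s hs t ht =>
      hM s t (mem_filter.1 hs).2 (mem_filter.1 ht).2
  | probe a v A B hA hB =>
    simp only [matchProb]
    split_ifs
    · refine hA _ fun s t => ?_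
      unfold Assignment.add
      split_ifs with hc
      · intro hs ht
        by_cases hau : a = u
        · subst hau
          have key : ∀ s, Function.update M v (some a) s = some a → s = v := by
            intro s hs
            by_contra hsv
            rw [Function.update_of_ne hsv] at hs
            exact hc.2 s hs
          rw [key s hs, key t ht]
        · have key : ∀ s, Function.update M v (some a) s = some u → M s = some u := by
            intro s hs
            by_cases hsv : s = v
            · subst hsv
              simp [hau] at hs
            · rwa [Function.update_of_ne hsv] at hs
          exact hM s t (key s hs) (key t ht)
      · exact hM s t
    · exact hB M hM
  | flip q A B hA hB =>
    simp only [matchProb, sum_add_distrib, ← mul_sum]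
    have h0 := q.2.1
    have h1 := q.2.2
    nlinarith [hA M hM, hB M hM]

/-- The matching probabilities of an unmatched online vertex `t` under an adaptive algorithm.
The edges from `t` to `S` have not been probed so far. -/
theorem matchProb_mem_probeHull [Fintype U] (t : V) (p : U → ℝ) (A : ProbingAlgorithm U V)
    (b : V → ℕ) (hA : A.RespectsPatience b) (M : Assignment U V) (hMt : M t = none)
    (S : Finset U) (q : U × V → ℝ) (h0 : ∀ e, 0 ≤ q e) (h1 : ∀ e, q e ≤ 1)
    (hS : ∀ u ∈ S, q (u, t) = p u) (hS' : ∀ u ∉ S, q (u, t) = 0 ∨ ∃ v, M v = some u) :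
    (fun u => ∑ c : U × V → Bool, bernoulliProb q c * A.matchProb (fun a v => c (a, v)) t u M) ∈
      probeHull p (b t) S := by
  induction A generalizing b M S q with
  | halt =>
    refine (congrArg (· ∈ probeHull p (b t) S) ?_).mp (zero_mem_probeHull p (b t) S)
    funext u
    simp [matchProb, hMt]
  | flip r A B ihA ihB =>
    have := convex_probeHull p (b t) S (ihA b hA.1 M hMt S q h0 h1 hS hS')
      (ihB b hA.2 M hMt S q h0 h1 hS hS') r.2.1 (sub_nonneg.2 r.2.2) (by ring)
    refine (congrArg (· ∈ probeHull p (b t) S) ?_).mp this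
    funext u
    simp only [matchProb, Pi.add_apply, Pi.smul_apply, smul_eq_mul, mul_sum, ← sum_add_distrib]
    exact sum_congr rfl fun c _ => by ring
  | probe a v A B ihA ihB =>
    obtain ⟨hb, hpA, hpB⟩ := hA
    have hup0 : ∀ x : ℝ, 0 ≤ x → ∀ e, 0 ≤ Function.update q (a, v) x e := by
      intro x hx e
      rw [Function.update_apply]
      split_ifs
      · exact hx
      · exact h0 e
    have hup1 : ∀ x : ℝ, x ≤ 1 → ∀ e, Function.update q (a, v) x e ≤ 1 := by
      intro x hx e
      rw [Function.update_apply]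
      split_ifs
      · exact hx
      · exact h1 e
    -- Conditioning on the answer sets `q (a, v)` to 1 or 0. Thus `q` remembers all revealed states,
    -- and repeated probes of an edge need no separate treatment.
    simp only [matchProb, sum_bernoulliProb_mul_ite]
    by_cases hvt : v = t
    · subst hvt
      have hne : ∀ (u : U) (x : ℝ), u ≠ a → Function.update q (a, v) x (u, v) = q (u, v) :=
        fun u x hu => Function.update_of_ne (by simpa using hu) _ _
      have hSx : ∀ x : ℝ, ∀ u ∈ S.erase a, Function.update q (a, v) x (u, v) = p u :=
        fun x u hu => by rw [hne u x (ne_of_mem_erase hu), hS u (mem_of_mem_erase hu)]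
      have hS0 : ∀ u ∉ S.erase a,
          Function.update q (a, v) 0 (u, v) = 0 ∨ ∃ v, M v = some u := by
        intro u hu
        by_cases hua : u = a
        · subst hua; simp
        · rw [hne u 0 hua]
          exact hS' u fun h => hu (mem_erase.2 ⟨hua, h⟩)
      have hzB := ihB _ hpB M hMt (S.erase a) _ (hup0 0 le_rfl) (hup1 0 zero_le_one) (hSx 0) hS0
      rw [Function.update_self] at hzB
      have hsub : probeHull p (b v - 1) (S.erase a) ⊆ probeHull p (b v) S :=
        probeHull_mono p (Nat.sub_le _ _) (erase_subset a S)
      -- If `a` is taken, neither answer changes the matching, and the result is a mixture of the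
      -- two continuations.
      by_cases hm : ∃ v', M v' = some a
      · have hadd : M.add a v = M := by
          unfold Assignment.add
          rw [if_neg]
          rintro ⟨-, h⟩
          exact h _ hm.choose_spec
        have hzA := ihA _ hpA M hMt (S.erase a) _ (hup0 1 zero_le_one) (hup1 1 le_rfl) (hSx 1)
          (by
            intro u hu
            by_cases hua : u = a
            · subst hua; exact Or.inr hm
            · rw [hne u 1 hua]
              exact hS' u fun h => hu (mem_erase.2 ⟨hua, h⟩))
        rw [Function.update_self] at hzA
        rw [hadd]
        exact convex_probeHull p (b v) S (hsub hzA) (hsub hzB) (h0 _) (sub_nonneg.2 (h1 _))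
          (by ring)
      · have hadd : M.add a v v = some a := by
          unfold Assignment.add
          rw [if_pos ⟨hMt, fun v' h => hm ⟨v', h⟩⟩, Function.update_self]
        simp only [matchProb_of_eq_some _ _ _ A hadd, ← sum_mul, sum_bernoulliProb, one_mul]
        -- For a fresh edge, the active branch ends with `t` matched to `a`, so the whole is `a`
        -- prepended to the inactive branch. Otherwise the edge is known to be inactive, and only
        -- the inactive branch counts.
        by_cases haS : a ∈ S
        · have := probeHull_cons p haS hzB
          rw [Nat.sub_add_cancel hb] at this
          refine (congrArg (· ∈ probeHull p (b v) S) ?_).mp this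
          funext u
          rw [hS a haS]
          simp
        · have hq : q (a, v) = 0 := (hS' a haS).resolve_right hm
          refine (congrArg (· ∈ probeHull p (b v) S) ?_).mp (hsub hzB)
          funext u
          simp [hq]
    -- A probe at another online vertex is just a coin flip for `t`; taken offline vertices stay
    -- taken.
    · have hne : ∀ (u : U) (x : ℝ), Function.update q (a, v) x (u, t) = q (u, t) :=
        fun u x => Function.update_of_ne (by simp [Ne.symm hvt]) _ _
      have hMt' : M.add a v t = none := by
        unfold Assignment.add
        split_ifs
        · rwa [Function.update_of_ne (Ne.symm hvt)]
        · exact hMt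
      have hM' : ∀ u, (∃ v, M v = some u) → ∃ v', M.add a v v' = some u := by
        rintro u ⟨w, hw⟩
        refine ⟨w, ?_⟩
        unfold Assignment.add
        split_ifs with hc
        · have : w ≠ v := by
            rintro rfl
            simp [hc.1] at hw
          rwa [Function.update_of_ne this]
        · exact hw
      have hzA := ihA _ hpA (M.add a v) hMt' S _ (hup0 1 zero_le_one) (hup1 1 le_rfl)
        (fun u hu => by rw [hne, hS u hu])
        (fun u hu => by rw [hne]; exact (hS' u hu).imp_right (hM' u))
      have hzB := ihB _ hpB M hMt S _ (hup0 0 le_rfl) (hup1 0 zero_le_one)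
        (fun u hu => by rw [hne, hS u hu]) (fun u hu => by rw [hne]; exact hS' u hu)
      rw [Function.update_of_ne (Ne.symm hvt)] at hzA hzB
      exact convex_probeHull p (b t) S hzA hzB (h0 _) (sub_nonneg.2 (h1 _)) (by ring)

end ProbingAlgorithm

/-! ### From committal algorithms to vectors of matching probabilities. -/

namespace StochasticGraph

variable {U V : Type*} [Fintype U] [Fintype V]

theorem stateProb_eq_bernoulliProb (G : StochasticGraph U V) (c : U × V → Bool) :
    G.stateProb (fun u v => c (u, v)) = bernoulliProb (fun e => G.prob e.1 e.2) c := by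
  rw [stateProb, bernoulliProb, Fintype.prod_prod_type]

variable [DecidableEq U] [DecidableEq V]

theorem sum_stateProb_mul (G : StochasticGraph U V) (f : (U → V → Bool) → ℝ) :
    ∑ st, G.stateProb st * f st =
      ∑ c, bernoulliProb (fun e => G.prob e.1 e.2) c * f (fun u v => c (u, v)) := by
  rw [← (Equiv.curry U V Bool).sum_comp]
  exact sum_congr rfl fun c _ => by rw [← stateProb_eq_bernoulliProb]; rfl

/-- Every committal algorithm is described by vectors of matching probabilities, one for each
online vertex. -/
theorem exists_matchProb (G : StochasticGraph U V) (A : ProbingAlgorithm U V)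
    (hA : A.RespectsPatience G.patience) :
    ∃ z : V → U → ℝ, (∀ t, z t ∈ probeHull (fun u => G.prob u t) (G.patience t) univ) ∧
      (∀ u, ∑ t, z t u ≤ 1) ∧ G.expectedValue A = ∑ t, ∑ u, G.weight u t * z t u := by
  refine ⟨fun t u => ∑ c, bernoulliProb (fun e => G.prob e.1 e.2) c *
    A.matchProb (fun u v => c (u, v)) t u (fun _ => none), fun t => ?_, fun u => ?_, ?_⟩
  · exact A.matchProb_mem_probeHull t _ _ hA _ rfl _ _ (fun _ => G.prob_nonneg _ _)
      (fun _ => G.prob_le_one _ _) (fun _ _ => rfl) (by simp)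
  · rw [sum_comm]
    simp only [← mul_sum]
    rw [← sum_bernoulliProb (fun e : U × V => G.prob e.1 e.2)]
    refine sum_le_sum fun c _ => mul_le_of_le_one_right
      (bernoulliProb_nonneg (fun _ => G.prob_nonneg _ _) (fun _ => G.prob_le_one _ _) c) ?_
    exact A.sum_matchProb_le_one _ u _ (by simp)
  · rw [expectedValue, sum_stateProb_mul]
    simp only [ProbingAlgorithm.valueOn_eq_sum_matchProb, mul_sum]
    rw [sum_comm]
    refine sum_congr rfl fun t _ => ?_
    rw [sum_comm]
    exact sum_congr rfl fun u _ => sum_congr rfl fun c _ => by ring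

end StochasticGraph

/-! ### The linear program: marginals, optimal solutions, relaxation. -/

namespace StochasticGraph

variable {U V : Type*} [Fintype U] [DecidableEq U]

/-- The expected number of times that `u` is proposed to by arrivals of type `v`, according to the
solution `y` of the linear program. -/
noncomputable def lpMarginal (G : StochasticGraph U V) (y : G.LPVar) (v : V) (u : U) : ℝ :=
  ∑ l, y v l * firstActive (fun u => G.prob u v) l.1 u

theorem lpMarginal_nonneg (G : StochasticGraph U V) {y : G.LPVar} {v : V} (hy : ∀ l, 0 ≤ y v l)
    (u : U) : 0 ≤ G.lpMarginal y v u :=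
  sum_nonneg fun l _ => mul_nonneg (hy l)
    (firstActive_nonneg (fun u => G.prob_nonneg u v) (fun u => G.prob_le_one u v) _ _)

variable [Fintype V]

theorem lpObjective_eq (G : StochasticGraph U V) (y : G.LPVar) :
    G.lpObjective y = ∑ v, ∑ u, G.weight u v * G.lpMarginal y v u := by
  refine sum_congr rfl fun v _ => ?_
  simp only [lpMarginal, mul_sum]
  rw [sum_comm]
  refine sum_congr rfl fun l _ => ?_
  rw [G.sum_mul_firstActiveProb_eq v l.1 (fun u => G.weight u v), sum_mul]
  exact sum_congr rfl fun u _ => by ring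

theorem sum_lpMarginal_eq (G : StochasticGraph U V) (y : G.LPVar) (u : U) :
    ∑ v, ∑ l : DistinctTuple U (G.patience v),
      ∑ i : Fin l.1.length with l.1.get i = u, G.firstActiveProb v l.1 i * y v l =
    ∑ v, G.lpMarginal y v u := by
  refine sum_congr rfl fun v _ => sum_congr rfl fun l _ => ?_
  rw [← sum_mul, sum_firstActiveProb_eq, mul_comm]

/-- Nonnegativity and the rate constraints confine the closed feasible set to a box, so it is
compact; it contains 0, and the objective is continuous. -/
theorem exists_lpOptimal (G : StochasticGraph U V) (r : V → ℝ) (hr : ∀ v, 0 ≤ r v) :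
    ∃ y : G.LPVar, G.LPOptimal r y := by
  have hcont : ∀ v u, Continuous fun y : G.LPVar => G.lpMarginal y v u := by
    intro v u
    unfold lpMarginal
    fun_prop
  have hclosed : IsClosed {y : G.LPVar | G.LPFeasible r y} := by
    have : {y : G.LPVar | G.LPFeasible r y} = {y | ∀ u, ∑ v, G.lpMarginal y v u ≤ 1} ∩
        ({y | ∀ v, ∑ l, y v l ≤ r v} ∩ {y | ∀ v l, 0 ≤ y v l}) := by
      ext y
      constructor
      · exact fun h => ⟨fun u => (G.sum_lpMarginal_eq y u).ge.trans (h.matching u), h.rate,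
          h.nonneg⟩
      · exact fun h => ⟨fun u => (G.sum_lpMarginal_eq y u).le.trans (h.1 u), h.2.1, h.2.2⟩
    rw [this]
    simp only [Set.ofPred_forall]
    refine IsClosed.inter ?_ (IsClosed.inter ?_ ?_)
    · exact isClosed_iInter fun u => isClosed_le (by fun_prop) continuous_const
    · exact isClosed_iInter fun v => isClosed_le (by fun_prop) continuous_const
    · exact isClosed_iInter fun v => isClosed_iInter fun l =>
        isClosed_le continuous_const (by fun_prop)
  have hcompact : IsCompact {y : G.LPVar | G.LPFeasible r y} := by
    refine IsCompact.of_isClosed_subset (isCompact_univ_pi fun v => isCompact_univ_pi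
      fun _ : DistinctTuple U (G.patience v) => isCompact_Icc (a := (0 : ℝ)) (b := r v))
      hclosed ?_
    intro y hy v _ l _
    exact ⟨hy.nonneg v l, (single_le_sum (fun l _ => hy.nonneg v l) (mem_univ l)).trans
      (hy.rate v)⟩
  have hobj : Continuous fun y : G.LPVar => G.lpObjective y := by
    simp only [lpObjective_eq]
    fun_prop
  obtain ⟨y, hy, hmax⟩ := hcompact.exists_isMaxOn
    ⟨0, by simp, by simpa using hr, by simp⟩ hobj.continuousOn
  exact ⟨y, hy, fun y' hy' => hmax hy'⟩

/-- In an optimal solution of the linear program, every offline vertex contributes a nonnegative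
amount to the objective. -/
theorem LPOptimal.sum_weight_mul_lpMarginal_nonneg {G : StochasticGraph U V} {r : V → ℝ}
    {y : G.LPVar} (hy : G.LPOptimal r y) (u : U) :
    0 ≤ ∑ v, G.weight u v * G.lpMarginal y v u := by
  have h : ∀ v, ∀ l : DistinctTuple U (G.patience v), ∃ q : DistinctTuple U (G.patience v) → ℝ,
      (∀ l, 0 ≤ q l) ∧ ∑ l, q l ≤ 1 ∧
      ∀ u', Function.update (firstActive (fun u => G.prob u v) l.1) u 0 u' =
        ∑ l, q l * firstActive (fun u => G.prob u v) l.1 u' := fun v l =>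
    exists_coeff_of_mem_probeHull (probeHull_mono _ l.2.2.2 subset_rfl
      (update_firstActive_mem_probeHull (fun u => G.prob_nonneg u v) (fun u => G.prob_le_one u v)
        u l.2.1 (S := univ) (by simp)))
  choose q hq0 hq1 hq using h
  -- Each tuple is replaced by its substitute that never matches `u`; by optimality of `y`, the
  -- share of `u` lost in this way cannot be negative.
  let y' : G.LPVar := fun v l' => ∑ l, y v l * q v l l'
  have hmarg : ∀ v, G.lpMarginal y' v = Function.update (G.lpMarginal y v) u 0 := by
    intro v
    funext u'
    have : G.lpMarginal y' v u' =
        ∑ l, y v l * Function.update (firstActive (fun u => G.prob u v) l.1) u 0 u' := by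
      simp only [lpMarginal, y', hq, mul_sum, sum_mul]
      rw [sum_comm]
      exact sum_congr rfl fun l _ => sum_congr rfl fun l' _ => by ring
    rw [this]
    by_cases hu : u' = u
    · subst hu; simp
    · simp [hu, lpMarginal]
  have hfeas : G.LPFeasible r y' := by
    refine ⟨fun a => ?_, fun v => ?_, fun v l =>
      sum_nonneg fun l' _ => mul_nonneg (hy.feasible.nonneg v l') (hq0 v l' l)⟩
    · rw [sum_lpMarginal_eq]
      refine le_trans ?_ ((sum_lpMarginal_eq G y a).ge.trans (hy.feasible.matching a))
      refine sum_le_sum fun v _ => ?_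
      rw [hmarg, Function.update_apply]
      split_ifs
      · exact G.lpMarginal_nonneg (hy.feasible.nonneg v) a
      · exact le_rfl
    · refine le_trans ?_ (hy.feasible.rate v)
      simp only [y']
      rw [sum_comm]
      refine sum_le_sum fun l _ => ?_
      rw [← mul_sum]
      exact mul_le_of_le_one_right (hy.feasible.nonneg v l) (hq1 v l)
  have hle := hy.optimal y' hfeas
  have hobj : G.lpObjective y = G.lpObjective y' + ∑ v, G.weight u v * G.lpMarginal y v u := by
    rw [lpObjective_eq, lpObjective_eq, ← sum_add_distrib]
    refine sum_congr rfl fun v _ => ?_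
    rw [hmarg, ← add_sum_erase _ _ (mem_univ u),
      ← add_sum_erase _ (fun a => G.weight a v * _) (mem_univ u), Function.update_self, mul_zero,
      zero_add, add_comm]
    congr 1
    refine sum_congr rfl fun a ha => ?_
    rw [Function.update_of_ne (ne_of_mem_erase ha)]
  linarith

section Arrivals

omit [Fintype U] [DecidableEq U]

variable {n : ℕ} {r : V → ℝ}

omit [Fintype V] in
theorem arrivalProb_nonneg (hr : ∀ v, 0 ≤ r v) (σ : Fin n → V) : 0 ≤ arrivalProb r σ :=
  prod_nonneg fun _ _ => div_nonneg (hr _) n.cast_nonneg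

theorem sum_rate_div (hn : 1 ≤ n) (hsum : ∑ v, r v = n) : ∑ v, r v / n = 1 := by
  rw [← sum_div, hsum, div_self]
  exact_mod_cast (by omega : n ≠ 0)

theorem sum_arrivalProb_mul (hn : 1 ≤ n) (hsum : ∑ v, r v = n) (t : Fin n) (f : V → ℝ) :
    ∑ σ : Fin n → V, arrivalProb r σ * f (σ t) = ∑ v, r v / n * f v := by
  classical
  -- With `f` inserted in factor `t` only, the sum factorizes over rounds, and every other factor is
  -- 1.
  have h := Fintype.prod_sum fun (s : Fin n) (v : V) => r v / n * if s = t then f v else 1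
  have hσ : ∀ σ : Fin n → V, ∏ s, (r (σ s) / n * if s = t then f (σ s) else 1) =
      arrivalProb r σ * f (σ t) := by
    intro σ
    rw [prod_mul_distrib, prod_ite_eq' univ t fun s => f (σ s)]
    simp [arrivalProb]
  simp only [hσ] at h
  rw [← h, prod_eq_single t]
  · simp
  · intro s _ hs
    simp [hs, sum_rate_div hn hsum]
  · simp

theorem sum_arrivalProb (hn : 1 ≤ n) (hsum : ∑ v, r v = n) :
    ∑ σ : Fin n → V, arrivalProb r σ = 1 := by
  have h := sum_arrivalProb_mul hn hsum ⟨0, hn⟩ fun _ => 1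
  simpa [sum_rate_div hn hsum] using h

end Arrivals

/-- The linear program is a relaxation of the committal benchmark. -/
theorem OPTiid_le_lpObjective (G : StochasticGraph U V) {n : ℕ} (hn : 1 ≤ n) {r : V → ℝ}
    (hr : ∀ v, 0 ≤ r v) (hsum : ∑ v, r v = n) {y : G.LPVar} (hy : G.LPOptimal r y) :
    G.OPTiid r n ≤ G.lpObjective y := by
  classical
  -- The supremum defining `OPT` is not assumed to be attained, so each arrival sequence gets an
  -- `ε`-optimal algorithm.
  refine le_of_forall_pos_le_add fun ε hε => ?_
  have hA : ∀ σ : Fin n → V, ∃ z : Fin n → U → ℝ,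
      (∀ t, z t ∈ probeHull (fun u => G.prob u (σ t)) (G.patience (σ t)) univ) ∧
      (∀ u, ∑ t, z t u ≤ 1) ∧
      (G.instantiate σ).OPT ≤ ∑ t, ∑ u, G.weight u (σ t) * z t u + ε := by
    intro σ
    obtain ⟨x, ⟨A, hA, rfl⟩, hx⟩ := exists_lt_of_lt_csSup
      (G.instantiate σ).committalValues_nonempty (sub_lt_self (G.instantiate σ).OPT hε)
    obtain ⟨z, hz, hz1, hzA⟩ := (G.instantiate σ).exists_matchProb A hA
    refine ⟨z, hz, hz1, ?_⟩
    rw [hzA] at hx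
    exact (sub_lt_iff_lt_add.1 hx).le
  choose z hz hz1 hzOPT using hA
  have hq : ∀ (σ : Fin n → V) (t : Fin n) (v : V), ∃ q : DistinctTuple U (G.patience v) → ℝ,
      (∀ l, 0 ≤ q l) ∧ (∑ l, q l ≤ if σ t = v then 1 else 0) ∧
      ∀ u, (if σ t = v then z σ t u else 0) =
        ∑ l, q l * firstActive (fun u => G.prob u v) l.1 u := by
    intro σ t v
    by_cases h : σ t = v
    · subst h
      simpa using exists_coeff_of_mem_probeHull (hz σ t)
    · exact ⟨0, by simp [h]⟩
  choose q hq0 hq1 hqz using hq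
  -- The expected number of arrivals of type `v` at which the tuple `l` is used.
  let y' : G.LPVar := fun v l => ∑ σ : Fin n → V, arrivalProb r σ * ∑ t, q σ t v l
  have hmarg : ∀ v u, G.lpMarginal y' v u =
      ∑ σ : Fin n → V, arrivalProb r σ * ∑ t, if σ t = v then z σ t u else 0 := by
    intro v u
    simp only [lpMarginal, y', hqz, sum_mul, mul_sum]
    rw [sum_comm]
    refine sum_congr rfl fun σ _ => ?_
    rw [sum_comm]
    exact sum_congr rfl fun t _ => sum_congr rfl fun l _ => by ring
  have hsumm : ∀ (w : V → U → ℝ) u, ∑ v, w v u * G.lpMarginal y' v u =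
      ∑ σ : Fin n → V, arrivalProb r σ * ∑ t, w (σ t) u * z σ t u := by
    intro w u
    simp only [hmarg, mul_sum]
    rw [sum_comm]
    refine sum_congr rfl fun σ _ => ?_
    rw [sum_comm]
    refine sum_congr rfl fun t _ => ?_
    simp
    ring
  have hfeas : G.LPFeasible r y' := by
    refine ⟨fun u => ?_, fun v => ?_, fun v l => sum_nonneg fun σ _ =>
      mul_nonneg (arrivalProb_nonneg hr σ) (sum_nonneg fun t _ => hq0 σ t v l)⟩
    · rw [sum_lpMarginal_eq]
      have := hsumm (fun _ _ => 1) u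
      simp only [one_mul] at this
      rw [this, ← sum_arrivalProb hn hsum]
      exact sum_le_sum fun σ _ => mul_le_of_le_one_right (arrivalProb_nonneg hr σ) (hz1 σ u)
    · simp only [y']
      rw [sum_comm]
      calc ∑ σ : Fin n → V, ∑ l, arrivalProb r σ * ∑ t, q σ t v l
          ≤ ∑ σ : Fin n → V, arrivalProb r σ * ∑ t, (if σ t = v then 1 else 0) := by
            refine sum_le_sum fun σ _ => ?_
            rw [← mul_sum, sum_comm]
            exact mul_le_mul_of_nonneg_left (sum_le_sum fun t _ => hq1 σ t v)
              (arrivalProb_nonneg hr σ)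
        _ = r v := by
            simp only [mul_sum]
            rw [sum_comm]
            simp only [fun t => sum_arrivalProb_mul hn hsum t fun x => if x = v then (1 : ℝ) else 0]
            have : (n : ℝ) ≠ 0 := by exact_mod_cast (by omega : n ≠ 0)
            simp
            field_simp
  have hobj : G.lpObjective y' =
      ∑ σ : Fin n → V, arrivalProb r σ * ∑ t, ∑ u, G.weight u (σ t) * z σ t u := by
    rw [lpObjective_eq, sum_comm]
    simp only [hsumm fun v u => G.weight u v]
    rw [sum_comm]
    refine sum_congr rfl fun σ _ => ?_
    rw [← mul_sum, sum_comm]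
  calc G.OPTiid r n
      ≤ ∑ σ : Fin n → V, arrivalProb r σ * (∑ t, ∑ u, G.weight u (σ t) * z σ t u + ε) :=
        sum_le_sum fun σ _ => mul_le_mul_of_nonneg_left (hzOPT σ) (arrivalProb_nonneg hr σ)
    _ = G.lpObjective y' + ε := by
        simp only [mul_add, sum_add_distrib, ← sum_mul, sum_arrivalProb hn hsum, hobj, one_mul]
    _ ≤ G.lpObjective y + ε := by linarith [hy.optimal y' hfeas]

end StochasticGraph

/-! ### The matching built by the algorithm, and its expected weight. -/

namespace StochasticGraph

section Matching

variable {U : Type*} [DecidableEq U] {n : ℕ}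

/-- Induction on the rounds processed so far. The second conjunct is needed in the induction: an
earlier proposal to `u` blocks a later one because some round was then matched to `u`. -/
theorem foldl_add_eq_some_iff (o : Fin n → Option U) (L : List (Fin n)) (hL : L.Pairwise (· < ·)) :
    (∀ t u, L.foldl (fun (M : Assignment U (Fin n)) t => (o t).elim M (fun u => M.add u t))
        (fun _ => none) t = some u ↔ t ∈ L ∧ o t = some u ∧ ∀ s ∈ L, s < t → o s ≠ some u) ∧
    ∀ s ∈ L, ∀ u, o s = some u → ∃ t, L.foldl
      (fun (M : Assignment U (Fin n)) t => (o t).elim M (fun u => M.add u t))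
        (fun _ => none) t = some u := by
  induction L using List.reverseRecOn with
  | nil => simp
  | append_singleton L t₀ ih =>
    rw [List.pairwise_append] at hL
    obtain ⟨ih1, ih2⟩ := ih hL.1
    have hlt : ∀ s ∈ L, s < t₀ := fun s hs => hL.2.2 s hs t₀ (by simp)
    have ht₀ : t₀ ∉ L := fun h => lt_irrefl _ (hlt _ h)
    simp only [List.foldl_append, List.foldl_cons, List.foldl_nil]
    set M := L.foldl (fun (M : Assignment U (Fin n)) t => (o t).elim M (fun u => M.add u t))
        (fun _ => none)
    have hMt₀ : M t₀ = none := by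
      cases h : M t₀ with
      | none => rfl
      | some u => exact absurd ((ih1 t₀ u).1 h).1 ht₀
    have hne : ∀ t, t ≠ t₀ → (o t₀).elim M (fun u => M.add u t₀) t = M t := by
      intro t ht
      cases o t₀ with
      | none => rfl
      | some a =>
        simp only [Option.elim, Assignment.add]
        split_ifs
        · rw [Function.update_of_ne ht]
        · rfl
    have heq : ∀ u, (o t₀).elim M (fun u => M.add u t₀) t₀ = some u ↔
        o t₀ = some u ∧ ∀ s ∈ L, o s ≠ some u := by
      intro u
      cases o t₀ with
      | none => simp [hMt₀]
      | some a =>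
        simp only [Option.elim, Assignment.add, hMt₀, true_and]
        split_ifs with h
        · simp only [Function.update_self]
          refine ⟨fun hu => ⟨hu, fun s hs hsu => ?_⟩, And.left⟩
          obtain ⟨t, ht⟩ := ih2 s hs u hsu
          exact h t (ht.trans hu.symm)
        · simp only [hMt₀, reduceCtorEq, false_iff]
          rintro ⟨hu, hs⟩
          refine h fun t ht => ?_
          obtain ⟨htL, hto, -⟩ := (ih1 t a).1 ht
          exact hs t htL (hto.trans hu)
    have hpart1 : ∀ t u, (o t₀).elim M (fun u => M.add u t₀) t = some u ↔
        t ∈ L ++ [t₀] ∧ o t = some u ∧ ∀ s ∈ L ++ [t₀], s < t → o s ≠ some u := by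
      intro t u
      by_cases ht : t = t₀
      · subst ht
        rw [heq]
        simp only [List.mem_append, List.mem_singleton, or_true, true_and]
        refine and_congr_right fun _ => ⟨fun h s hs hst => h s (hs.resolve_right hst.ne),
          fun h s hs => h s (Or.inl hs) (hlt s hs)⟩
      · rw [hne t ht, ih1]
        simp only [List.mem_append, List.mem_singleton, ht, or_false]
        refine and_congr_right fun htL => and_congr_right fun _ => ⟨fun h s hs hst => ?_,
          fun h s hs => h s (Or.inl hs)⟩
        rcases hs with hs | rfl
        · exact h s hs hst
        · exact absurd hst (hlt t htL).not_gt
    refine ⟨hpart1, fun s hs u hsu => ?_⟩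
    by_cases hex : ∃ s ∈ L, o s = some u
    · obtain ⟨s, hs, hsu⟩ := hex
      obtain ⟨t, ht⟩ := ih2 s hs u hsu
      refine ⟨t, ?_⟩
      rw [hne t, ht]
      rintro rfl
      exact ht₀ ((ih1 _ u).1 ht).1
    · push Not at hex
      rcases List.mem_append.1 hs with hs | hs
      · exact absurd hsu (hex s hs)
      · rw [List.mem_singleton] at hs
        subst hs
        exact ⟨s, (heq u).2 ⟨hsu, hex⟩⟩

theorem iidMatching_eq_some_iff {V : Type*} [Fintype U] (G : StochasticGraph U V) (σ : Fin n → V)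
    (d : (t : Fin n) → Option (DistinctTuple U (G.patience (σ t)))) (st : U → Fin n → Bool)
    (t : Fin n) (u : U) : G.iidMatching σ d st t = some u ↔
      vertexProbe (fun a => st a t) (d t) = some u ∧
        ∀ s < t, vertexProbe (fun a => st a s) (d s) ≠ some u := by
  have h := (foldl_add_eq_some_iff (fun t => vertexProbe (fun a => st a t) (d t))
    (List.finRange n) (List.pairwise_lt_finRange n)).1 t u
  simpa [iidMatching] using h

end Matching

variable {U V : Type*} [Fintype U] [DecidableEq U]

/-- The probability that `VertexProbe` returns `u`. -/
theorem sum_drawProb_vertexProbe {k : ℕ} (x : DistinctTuple U k → ℝ) (p : U → ℝ) (u : U) :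
    ∑ d : Option (DistinctTuple U k), drawProb x d *
      ∑ c, bernoulliProb p c * (if vertexProbe c d = some u then 1 else 0) =
    ∑ l, x l * firstActive p l.1 u := by
  have h0 : ∀ c : U → Bool, vertexProbe c (none : Option (DistinctTuple U k)) ≠ some u := by
    simp [vertexProbe]
  have h1 : ∀ l : DistinctTuple U k,
      ∑ c, bernoulliProb p c * (if vertexProbe c (some l) = some u then 1 else 0) =
        firstActive p l.1 u := fun l => sum_bernoulliProb_find p l.2.1 u
  rw [Fintype.sum_option]
  simp only [h1, if_neg (h0 _), mul_zero, sum_const_zero, zero_add]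
  rfl

theorem sum_drawProb {k : ℕ} (x : DistinctTuple U k → ℝ) : ∑ d, drawProb x d = 1 := by
  rw [Fintype.sum_option]
  simp [drawProb]

/-- The rounds are independent, given the arrivals. -/
theorem sum_stateProb_mul_prod (G : StochasticGraph U V) {n : ℕ} (σ : Fin n → V)
    {D : Fin n → Type*} [∀ t, Fintype (D t)] (w : ∀ t, D t → ℝ)
    (h : ∀ t, D t → (U → Bool) → ℝ) :
    ∑ d : ∀ t, D t, (∏ t, w t (d t)) * ∑ st : U → Fin n → Bool,
      (G.instantiate σ).stateProb st * ∏ t, h t (d t) (fun u => st u t) =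
    ∏ t, ∑ d, w t d * ∑ c, bernoulliProb (fun u => G.prob u (σ t)) c * h t d c := by
  rw [Fintype.prod_sum]
  refine sum_congr rfl fun d _ => ?_
  rw [prod_mul_distrib, Fintype.prod_sum]
  congr 1
  -- Edge states are regrouped by rounds.
  rw [← (Equiv.piComm fun (_ : Fin n) (_ : U) => Bool).sum_comp]
  refine sum_congr rfl fun c _ => ?_
  rw [prod_mul_distrib]
  congr 1
  rw [stateProb, prod_comm]
  rfl

/-- The sum is smallest at `a = 1/n`, where the geometric series gives `1 - (1 - 1/n) ^ n`, and `(1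
- 1/n) ^ n ≤ 1/e`. -/
theorem sum_range_pow_div_ge {n : ℕ} (hn : 1 ≤ n) {a : ℝ} (ha1 : a ≤ 1 / n) :
    1 - 1 / Real.exp 1 ≤ (∑ t : Fin n, (1 - a) ^ (t : ℕ)) / n := by
  have hn0 : (0 : ℝ) < n := by exact_mod_cast hn
  have hb : (0 : ℝ) ≤ 1 - 1 / n := by
    rw [sub_nonneg, div_le_one hn0]
    exact_mod_cast hn
  have hsum : ∑ t : Fin n, (1 - 1 / (n : ℝ)) ^ (t : ℕ) = n * (1 - (1 - 1 / (n : ℝ)) ^ n) := by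
    rw [Fin.sum_univ_eq_sum_range (fun t => (1 - 1 / (n : ℝ)) ^ t) n]
    have := mul_neg_geom_sum (1 - 1 / (n : ℝ)) n
    rw [← this]
    field_simp
    ring
  have hexp : (1 - 1 / (n : ℝ)) ^ n ≤ 1 / Real.exp 1 := by
    have h := Real.one_sub_div_pow_le_exp_neg (n := n) (t := 1) (by exact_mod_cast hn)
    rwa [Real.exp_neg, ← one_div] at h
  have hle : ∑ t : Fin n, (1 - 1 / (n : ℝ)) ^ (t : ℕ) ≤ ∑ t : Fin n, (1 - a) ^ (t : ℕ) :=
    sum_le_sum fun t _ => pow_le_pow_left₀ hb (by linarith) _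
  rw [le_div_iff₀ hn0]
  nlinarith

variable [Fintype V]

/-- In round `t`, the vertex `u` is still unmatched with probability `(1 - a) ^ t`, where `a` is the
probability that a single round proposes to `u`. -/
theorem iidAlgValue_eq (G : StochasticGraph U V) {n : ℕ} (hn : 1 ≤ n) {r : V → ℝ}
    (hr : ∀ v, 0 < r v) (hsum : ∑ v, r v = n) (y : G.LPVar) :
    G.iidAlgValue r n y = ∑ u, (∑ v, G.weight u v * G.lpMarginal y v u) *
      ((∑ t : Fin n, (1 - (∑ v, G.lpMarginal y v u) / n) ^ (t : ℕ)) / n) := by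
  classical
  -- The weight gained by matching round `t₀` to `u` as a product over rounds: round `t₀` proposes
  -- to `u`, earlier rounds do not, later rounds are free.
  let h (t₀ : Fin n) (u : U) (t : Fin n) (v : V) (d : Option (DistinctTuple U (G.patience v)))
      (c : U → Bool) : ℝ :=
    if t = t₀ then G.weight u v * (if vertexProbe c d = some u then 1 else 0)
    else if t < t₀ then 1 - (if vertexProbe c d = some u then 1 else 0) else 1
  have hval : ∀ (σ : Fin n → V) (d : (t : Fin n) → Option (DistinctTuple U (G.patience (σ t))))
      (st : U → Fin n → Bool), (G.instantiate σ).val (G.iidMatching σ d st) =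
        ∑ t₀, ∑ u, ∏ t, h t₀ u t (σ t) (d t) (fun a => st a t) := by
    intro σ d st
    refine sum_congr rfl fun t₀ _ => ?_
    have hprod : ∀ u, ∏ t, h t₀ u t (σ t) (d t) (fun a => st a t) =
        G.weight u (σ t₀) * if G.iidMatching σ d st t₀ = some u then 1 else 0 := by
      intro u
      by_cases h0 : vertexProbe (fun a => st a t₀) (d t₀) = some u
      · by_cases h1 : ∀ s < t₀, vertexProbe (fun a => st a s) (d s) ≠ some u
        · rw [if_pos ((G.iidMatching_eq_some_iff σ d st t₀ u).2 ⟨h0, h1⟩), prod_eq_single t₀]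
          · simp [h, h0]
          · intro s _ hs
            simp only [h, if_neg hs]
            split_ifs with h2 h3
            · exact absurd h3 (h1 s h2)
            · simp
            · rfl
          · simp
        · rw [if_neg fun hc => h1 ((G.iidMatching_eq_some_iff σ d st t₀ u).1 hc).2, mul_zero]
          push Not at h1
          obtain ⟨s, hs, hsu⟩ := h1
          exact prod_eq_zero (mem_univ s) (by simp [h, hs, hs.ne, hsu])
      · rw [if_neg fun hc => h0 ((G.iidMatching_eq_some_iff σ d st t₀ u).1 hc).1, mul_zero]
        exact prod_eq_zero (mem_univ t₀) (by simp [h, h0])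
    simp only [hprod]
    cases G.iidMatching σ d st t₀ <;> simp [instantiate]
  let a (u : U) : ℝ := (∑ v, G.lpMarginal y v u) / n
  have hround : ∀ t₀ u t, ∑ v, r v / n * ∑ d, drawProb (fun l => y v l / r v) d *
      ∑ c, bernoulliProb (fun u => G.prob u v) c * h t₀ u t v d c =
        if t = t₀ then (∑ v, G.weight u v * G.lpMarginal y v u) / n
        else if t < t₀ then 1 - a u else 1 := by
    intro t₀ u t
    have hm : ∀ v, r v / n * ∑ l, y v l / r v * firstActive (fun u => G.prob u v) l.1 u =
        G.lpMarginal y v u / n := by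
      intro v
      have hv := (hr v).ne'
      simp only [lpMarginal, mul_sum, sum_div]
      refine sum_congr rfl fun l _ => ?_
      field_simp
    by_cases h0 : t = t₀
    · simp only [h, if_pos h0]
      rw [sum_div]
      refine sum_congr rfl fun v _ => ?_
      simp only [mul_left_comm _ (G.weight u v), ← mul_sum, sum_drawProb_vertexProbe, hm]
      ring
    · by_cases h1 : t < t₀
      · simp only [h, if_neg h0, if_pos h1, mul_sub, mul_one, sum_sub_distrib,
          sum_bernoulliProb, sum_drawProb, sum_drawProb_vertexProbe, hm,
          sum_rate_div hn hsum, a, sum_div]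
      · simp only [h, if_neg h0, if_neg h1, mul_one, sum_bernoulliProb, sum_drawProb,
          sum_rate_div hn hsum]
  have hterm : ∀ t₀ u, ∑ σ : Fin n → V, arrivalProb r σ *
      ∑ d : (t : Fin n) → Option (DistinctTuple U (G.patience (σ t))),
        (∏ t, drawProb (fun l => y (σ t) l / r (σ t)) (d t)) *
          ∑ st : U → Fin n → Bool, (G.instantiate σ).stateProb st *
            ∏ t, h t₀ u t (σ t) (d t) (fun a => st a t) =
      (∑ v, G.weight u v * G.lpMarginal y v u) / n * (1 - a u) ^ (t₀ : ℕ) := by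
    intro t₀ u
    have h1 : ∀ σ : Fin n → V, _ := fun σ => G.sum_stateProb_mul_prod σ
      (fun t d => drawProb (fun l => y (σ t) l / r (σ t)) d) (fun t d c => h t₀ u t (σ t) d c)
    simp only [h1, arrivalProb, ← prod_mul_distrib]
    rw [← Fintype.prod_sum fun (t : Fin n) (v : V) => r v / n *
      ∑ d, drawProb (fun l => y v l / r v) d *
      ∑ c, bernoulliProb (fun u => G.prob u v) c * h t₀ u t v d c]
    simp only [hround]
    rw [← mul_prod_erase univ _ (mem_univ t₀), if_pos rfl]
    congr 1
    have : ∀ t ∈ univ.erase t₀, (if t = t₀ then (∑ v, G.weight u v * G.lpMarginal y v u) / n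
        else if t < t₀ then 1 - a u else 1) = if t < t₀ then 1 - a u else 1 :=
      fun t ht => if_neg (ne_of_mem_erase ht)
    -- The simplified factor equals 1 at `t₀`, so the product may run over all rounds; `t₀` of them
    -- precede round `t₀`.
    rw [prod_congr rfl this, prod_erase _ (by simp), prod_ite, prod_const, prod_const_one, mul_one]
    congr 1
    rw [← Fin.card_Iio t₀]
    congr 1
    ext t
    simp
  have hexpand : G.iidAlgValue r n y = ∑ x : Fin n × U, ∑ σ : Fin n → V, arrivalProb r σ *
      ∑ d : (t : Fin n) → Option (DistinctTuple U (G.patience (σ t))),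
        (∏ t, drawProb (fun l => y (σ t) l / r (σ t)) (d t)) *
          ∑ st : U → Fin n → Bool, (G.instantiate σ).stateProb st *
            ∏ t, h x.1 x.2 t (σ t) (d t) (fun a => st a t) := by
    rw [sum_comm, iidAlgValue]
    refine sum_congr rfl fun σ _ => ?_
    rw [← mul_sum, sum_comm]
    congr 1
    refine sum_congr rfl fun d _ => ?_
    rw [← mul_sum, sum_comm]
    congr 1
    refine sum_congr rfl fun st _ => ?_
    rw [← mul_sum, hval, Fintype.sum_prod_type]
  rw [hexpand, Fintype.sum_prod_type, sum_comm]
  refine sum_congr rfl fun u _ => ?_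
  simp only [hterm, ← mul_sum]
  simp only [a]
  ring

end StochasticGraph

/-! ### The competitive ratio. -/

theorem theorem4p3 {U V : Type*} [Fintype U] [DecidableEq U] [Fintype V]
    (G : StochasticGraph U V) (n : ℕ) (hn : 1 ≤ n) (r : V → ℝ) (hr : ∀ v, 0 < r v)
    (hsum : ∑ v, r v = n) :
    (∃ y : G.LPVar, G.LPOptimal r y) ∧
      ∀ y : G.LPVar, G.LPOptimal r y →
        (1 - 1 / Real.exp 1) * G.OPTiid r n ≤ G.iidAlgValue r n y := by
  refine ⟨G.exists_lpOptimal r fun v => (hr v).le, fun y hy => ?_⟩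
  have hn0 : (0 : ℝ) ≤ n := n.cast_nonneg
  have he : (0 : ℝ) ≤ 1 - 1 / Real.exp 1 := by
    rw [sub_nonneg, div_le_one (Real.exp_pos 1)]
    exact Real.one_le_exp zero_le_one
  calc (1 - 1 / Real.exp 1) * G.OPTiid r n
      ≤ (1 - 1 / Real.exp 1) * G.lpObjective y :=
        mul_le_mul_of_nonneg_left (G.OPTiid_le_lpObjective hn (fun v => (hr v).le) hsum hy) he
    _ = ∑ u, (∑ v, G.weight u v * G.lpMarginal y v u) * (1 - 1 / Real.exp 1) := by
        rw [G.lpObjective_eq, Finset.sum_comm, ← Finset.sum_mul, mul_comm]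
    _ ≤ G.iidAlgValue r n y := by
        rw [G.iidAlgValue_eq hn hr hsum]
        refine Finset.sum_le_sum fun u _ => mul_le_mul_of_nonneg_left
          (StochasticGraph.sum_range_pow_div_ge hn ?_) (hy.sum_weight_mul_lpMarginal_nonneg u)
        -- The matching constraint at `u`, divided by `n`, bounds the proposal probability by `1/n`.
        exact div_le_div_of_nonneg_right
          ((G.sum_lpMarginal_eq y u).ge.trans (hy.feasible.matching u)) hn0
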